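/- Consider the one-component two-dimensional sinusoidal model $$y(t,s)=A^0\cos(\lambda^0t+\mu^0s)+B^0\sin(\lambda^0t+\mu^0s)+\epsilon(t,s),\qquad t,s=1,2,\dots$$ Let $K\subset\mathbb R$ be compact, let $\Theta=K\times K\times[0,\pi]\times[0,\pi]$, and suppose that the true parameter $\theta_0=(A^0,B^0,\lambda^0,\mu^0)$ is an interior point of $\Theta$ and that the signal is not identically zero, i.e. $(A^0,B^0)\ne(0,0)$. Suppose that the $\epsilon(t,s)$ are independent and identically distributed real random variables with $\mathbb E[\epsilon(t,s)^2]<\infty$, whose common distribution function $G$ has a unique median at $0$ (that is, $G(x)=\tfrac12$ if and only if $x=0$) and a continuous probability density $g$ that is differentiable on $\mathbb R$ with bounded derivative $g'$. For $T,S\ge 1$ let $\hat\theta_{T,S}$ be a least absolute deviation (LAD) estimator, i.e. any minimiser over $\theta=(A,B,\lambda,\mu)\in\Theta$ of $$Q_{T,S}(\theta)=\frac1{TS}\sum_{t=1}^{T}\sum_{s=1}^{S}\bigl|y(t,s)-A\cos(\lambda t+\mu s)-B\sin(\lambda t+\mu s)\bigr|.$$ Then $\hat\theta_{T,S}\to\theta_0$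 almost surely as $\min\{T,S\}\to\infty$. -/

import Mathlib

open MeasureTheory ProbabilityTheory Filter Topology

namespace LADSinusoid

/-- Parameter vectors `θ = (A, B, lam, mu)` of the one-component model. -/
abbrev Param : Type := ℝ × ℝ × ℝ × ℝ

/-- The deterministic component `A cos(lam t + mu s) + B sin(lam t + mu s)`. -/
noncomputable def signal (θ : Param) (t s : ℕ) : ℝ :=
  θ.1 * Real.cos (θ.2.2.1 * t + θ.2.2.2 * s) + θ.2.1 * Real.sin (θ.2.2.1 * t + θ.2.2.2 * s)

/-- The observations `y(t,s) = signal + noise`, at the true parameter `θ₀`.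
Only the indices `t, s ≥ 1` matter. -/
noncomputable def obs {Ω : Type*} (θ₀ : Param) (ε : ℕ → ℕ → Ω → ℝ) (t s : ℕ) (ω : Ω) : ℝ :=
  signal θ₀ t s + ε t s ω

/-- The mean absolute residual `Q_{T,S}(θ)` of a data array `y`. -/
noncomputable def meanAbsResidual (y : ℕ → ℕ → ℝ) (T S : ℕ) (θ : Param) : ℝ :=
  (1 / ((T : ℝ) * (S : ℝ))) *
    ∑ t ∈ Finset.Icc 1 T, ∑ s ∈ Finset.Icc 1 S, |y t s - signal θ t s|

/-- The parameter space `Θ = K × K × [0,π] × [0,π]`. -/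
def paramSpace (K : Set ℝ) : Set Param :=
  K ×ˢ K ×ˢ Set.Icc 0 Real.pi ×ˢ Set.Icc 0 Real.pi

/-- `θhat` is a least absolute deviation estimator over `Θ` for the random data `y`: for all
sample sizes `T, S ≥ 1` and every outcome, `θhat T S ω` is a minimiser of `Q_{T,S}` over `Θ`. -/
def IsLADEstimator {Ω : Type*} (Θ : Set Param) (y : ℕ → ℕ → Ω → ℝ)
    (θhat : ℕ → ℕ → Ω → Param) : Prop :=
  ∀ T S : ℕ, 1 ≤ T → 1 ≤ S → ∀ ω : Ω,
    θhat T S ω ∈ Θ ∧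
      IsMinOn (meanAbsResidual (fun t s => y t s ω) T S) Θ (θhat T S ω)

/-- The assumptions on the noise: the `ε(t,s)`, `t, s ≥ 1`, are independent random variables with
the common density `g`, which is continuous and differentiable with bounded derivative; the
common distribution function takes the value `1/2` at `0` and only there (so that `0` is the
unique median); and the second moment is finite. -/
structure NoiseAssumption {Ω : Type*} [MeasurableSpace Ω] (P : Measure Ω)
    (ε : ℕ → ℕ → Ω → ℝ) (g : ℝ → ℝ) : Prop where
  measurable : ∀ t s : ℕ+, Measurable (ε t s)
  indep : iIndepFun (fun (p : ℕ+ × ℕ+) => ε p.1 p.2) P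
  density_nonneg : ∀ x, 0 ≤ g x
  density_continuous : Continuous g
  law : ∀ t s : ℕ+, P.map (ε t s) = volume.withDensity (fun x => ENNReal.ofReal (g x))
  unique_median : ∀ t s : ℕ+, ∀ x : ℝ, cdf (P.map (ε t s)) x = 1 / 2 ↔ x = 0
  density_differentiable : Differentiable ℝ g
  density_deriv_bounded : ∃ M : ℝ, ∀ x, |deriv g x| ≤ M
  finite_second_moment : ∀ t s : ℕ+, MemLp (ε t s) 2 P

end LADSinusoid

/-!
Write `h` for the gap between the signals at the true parameter `θ₀` and at `θ`. The expected excess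
`E (|ε + h| - |ε|)` is nonnegative, and uniqueness of the median bounds it away from `0` for
`|h| ≥ η`. Hoeffding's inequality on a net of polynomial cardinality, with the Borel–Cantelli lemma,
shows that almost surely the total excess falls short of its expectation by at most `δ T S`,
uniformly in `θ` and for all but finitely many pairs `(T, S)`. The total excess is nonpositive at a
minimiser, so all but a small fraction of the grid points have gap at most `η`. Hence there are
offsets `a, b` for which the gap is small on the 3 × 3 blocks at `(a, b)` and `(2a, 2b)`. By
three-term recurrences, the first block forces the frequencies to be close and identifies the
complex amplitude up to the phase of the translation by `(a, b)`; the second block sees twice that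
phase, and comparing the two eliminates it.
-/

namespace LADSinusoid

section Identifiability

open Complex (I)

variable {z w : ℂ} {lam mu lam₀ mu₀ : ℝ}

/-- The unimodular factor `exp (-i (lam t + mu s))` by which a translation of the grid by `(t, s)`
multiplies the complex amplitude of a sinusoid with frequencies `(lam, mu)`. -/
noncomputable def phase (lam mu : ℝ) (t s : ℕ) : ℂ :=
  Complex.exp ((-(lam * t + mu * s) : ℝ) * I)

lemma norm_phase (lam mu : ℝ) (t s : ℕ) : ‖phase lam mu t s‖ = 1 :=
  Complex.norm_exp_ofReal_mul_I _

lemma phase_ne_zero (lam mu : ℝ) (t s : ℕ) : phase lam mu t s ≠ 0 :=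
  Complex.exp_ne_zero _

lemma phase_add (lam mu : ℝ) (a b i j : ℕ) :
    phase lam mu (a + i) (b + j) = phase lam mu a b * phase lam mu i j := by
  rw [phase, phase, phase, ← Complex.exp_add]
  push_cast
  ring_nf

lemma phase_two_mul (lam mu : ℝ) (a b : ℕ) :
    phase lam mu (2 * a) (2 * b) = phase lam mu a b ^ 2 := by
  rw [two_mul, two_mul, phase_add, sq]

lemma norm_phase_sub_phase_le (lam mu lam' mu' : ℝ) (t s : ℕ) :
    ‖phase lam mu t s - phase lam' mu' t s‖ ≤ |lam - lam'| * t + |mu - mu'| * s := by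
  have hfactor : phase lam mu t s - phase lam' mu' t s = phase lam' mu' t s *
      (Complex.exp (I * ((lam' - lam) * t + (mu' - mu) * s : ℝ)) - 1) := by
    rw [phase, phase, mul_sub_one, ← Complex.exp_add]
    push_cast
    ring_nf
  rw [hfactor, norm_mul, norm_phase, one_mul]
  refine (Real.norm_exp_I_mul_ofReal_sub_one_le).trans ((norm_add_le _ _).trans_eq ?_)
  simp only [norm_mul, Real.norm_eq_abs, Nat.abs_cast, abs_sub_comm]

/-- The real sinusoid with complex amplitude `z` and frequencies `(lam, mu)`; its coefficients on
cosine and sine are `Re z` and `Im z`. -/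
noncomputable def wave (z : ℂ) (lam mu : ℝ) (t s : ℕ) : ℝ :=
  (z * phase lam mu t s).re

lemma wave_eq_cos_add_sin (z : ℂ) (lam mu : ℝ) (t s : ℕ) :
    wave z lam mu t s =
      z.re * Real.cos (lam * t + mu * s) + z.im * Real.sin (lam * t + mu * s) := by
  simp [wave, phase, Complex.exp_ofReal_mul_I_re, Complex.exp_ofReal_mul_I_im, -Complex.ofReal_neg,
    -neg_add_rev]

lemma wave_comm (z : ℂ) (lam mu : ℝ) (t s : ℕ) : wave z lam mu t s = wave z mu lam s t := by
  rw [wave_eq_cos_add_sin, wave_eq_cos_add_sin, add_comm (lam * t)]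

lemma wave_sub (z w : ℂ) (lam mu : ℝ) (t s : ℕ) :
    wave (z - w) lam mu t s = wave z lam mu t s - wave w lam mu t s := by
  rw [wave, wave, wave, sub_mul, Complex.sub_re]

lemma wave_add (z : ℂ) (lam mu : ℝ) (a b i j : ℕ) :
    wave z lam mu (a + i) (b + j) = wave (z * phase lam mu a b) lam mu i j := by
  rw [wave, wave, phase_add, mul_assoc]

lemma wave_add_wave_add_two (z : ℂ) (lam mu : ℝ) (t s : ℕ) :
    wave z lam mu t s + wave z lam mu (t + 2) s =
      2 * Real.cos lam * wave z lam mu (t + 1) s := by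
  set x := lam * (t + 1 : ℕ) + mu * s with hx
  have h0 : lam * t + mu * s = x - lam := by rw [hx]; push_cast; ring
  have h2 : lam * (t + 2 : ℕ) + mu * s = x + lam := by rw [hx]; push_cast; ring
  simp only [wave_eq_cos_add_sin, h0, h2, ← hx, Real.cos_sub, Real.sin_sub, Real.cos_add,
    Real.sin_add]
  ring

lemma eq_zero_of_wave_eq_zero (hmu : Real.sin mu ≠ 0) {t s : ℕ} (h0 : wave z lam mu t s = 0)
    (h1 : wave z lam mu t (s + 1) = 0) : z = 0 := by
  set u := z * phase lam mu t s with hu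
  have hre : u.re = 0 := h0
  have him : u.im = 0 := by
    rw [← add_zero t, wave_add, ← hu, wave_eq_cos_add_sin, hre] at h1
    simpa [hmu] using h1
  exact (mul_eq_zero.1 (Complex.ext hre him : u = 0)).resolve_right (phase_ne_zero _ _ _ _)

lemma cos_eq_of_wave_eq (hw : w ≠ 0) (hmu₀ : Real.sin mu₀ ≠ 0)
    (h : ∀ i < 3, ∀ j < 2, wave z lam mu i j = wave w lam₀ mu₀ i j) :
    Real.cos lam = Real.cos lam₀ := by
  by_contra hne
  have hvanish : ∀ j < 2, wave w lam₀ mu₀ 1 j = 0 := by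
    intro j hj
    have hrec := wave_add_wave_add_two z lam mu 0 j
    rw [h 0 (by lia) j hj, h 1 (by lia) j hj, h 2 (by lia) j hj,
      wave_add_wave_add_two w lam₀ mu₀ 0 j] at hrec
    by_contra h0
    exact hne (mul_left_cancel₀ two_ne_zero (mul_right_cancel₀ h0 hrec)).symm
  exact hw (eq_zero_of_wave_eq_zero hmu₀ (hvanish 0 (by lia)) (hvanish 1 (by lia)))

lemma eq_of_wave_eq (hw : w ≠ 0) (hlam₀ : lam₀ ∈ Set.Ioo 0 Real.pi)
    (hmu₀ : mu₀ ∈ Set.Ioo 0 Real.pi) (hlam : lam ∈ Set.Icc 0 Real.pi)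
    (hmu : mu ∈ Set.Icc 0 Real.pi)
    (h : ∀ i < 3, ∀ j < 3, wave z lam mu i j = wave w lam₀ mu₀ i j) :
    z = w ∧ lam = lam₀ ∧ mu = mu₀ := by
  have hsin_lam := (Real.sin_pos_of_mem_Ioo hlam₀).ne'
  have hsin_mu := (Real.sin_pos_of_mem_Ioo hmu₀).ne'
  obtain rfl : lam = lam₀ := Real.injOn_cos hlam (Set.Ioo_subset_Icc_self hlam₀) <|
    cos_eq_of_wave_eq hw hsin_mu fun i hi j hj => h i hi j (by lia)
  obtain rfl : mu = mu₀ := Real.injOn_cos hmu (Set.Ioo_subset_Icc_self hmu₀) <|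
    cos_eq_of_wave_eq hw hsin_lam fun i hi j hj => by
      rw [wave_comm z, wave_comm w, h j (by lia) i hi]
  have hdiff : ∀ i < 3, wave (z - w) mu lam 0 i = 0 := fun i hi => by
    rw [wave_comm, wave_sub, h i hi 0 (by lia), sub_self]
  have hzw := eq_zero_of_wave_eq_zero hsin_lam (hdiff 0 (by lia)) (hdiff 1 (by lia))
  exact ⟨sub_eq_zero.1 hzw, rfl, rfl⟩

lemma exists_dist_lt_of_block_close (R : ℝ) {r : ℝ} (hr : 0 < r)
    (hlam₀ : lam₀ ∈ Set.Ioo 0 Real.pi) (hmu₀ : mu₀ ∈ Set.Ioo 0 Real.pi) {δ : ℝ} (hδ : 0 < δ) :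
    ∃ η > 0, ∀ (z w : ℂ) (lam mu : ℝ), ‖z‖ ≤ R → ‖w‖ = r → lam ∈ Set.Icc 0 Real.pi →
      mu ∈ Set.Icc 0 Real.pi →
      (∀ i < 3, ∀ j < 3, |wave w lam₀ mu₀ i j - wave z lam mu i j| < η) →
      dist (z, lam, mu) (w, lam₀, mu₀) < δ := by
  let far : Set (ℂ × ℂ × ℝ × ℝ) :=
    (Metric.closedBall 0 R ×ˢ Metric.sphere 0 r ×ˢ Set.Icc 0 Real.pi ×ˢ Set.Icc 0 Real.pi) ∩
      {p | δ ≤ dist (p.1, p.2.2) (p.2.1, lam₀, mu₀)}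
  let blockDist : ℂ × ℂ × ℝ × ℝ → ℝ := fun p => ‖fun i : Fin 3 × Fin 3 =>
    wave p.2.1 lam₀ mu₀ i.1 i.2 - wave p.1 p.2.2.1 p.2.2.2 i.1 i.2‖
  have hfar : IsCompact far :=
    ((isCompact_closedBall _ _).prod ((isCompact_sphere _ _).prod
      (isCompact_Icc.prod isCompact_Icc))).inter_right
      (isClosed_le continuous_const (by fun_prop))
  have hcont : Continuous blockDist := by
    simp only [blockDist, wave_eq_cos_add_sin]
    fun_prop
  have hpos : ∀ p ∈ far, 0 < blockDist p := by
    rintro ⟨z, w, lam, mu⟩ ⟨⟨-, hw, hlam, hmu⟩, hsep⟩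
    refine norm_pos_iff.2 fun hzero => hδ.not_ge ?_
    obtain ⟨hz, hl, hm⟩ := eq_of_wave_eq (Metric.ne_of_mem_sphere hw hr.ne') hlam₀ hmu₀ hlam hmu
      fun i hi j hj => (sub_eq_zero.1 (congrFun hzero (⟨i, hi⟩, ⟨j, hj⟩))).symm
    exact le_of_le_of_eq hsep (dist_eq_zero.2 (Prod.ext hz (Prod.ext hl hm)))
  obtain ⟨η, hη, hle⟩ := hfar.exists_forall_le' hcont.continuousOn hpos
  refine ⟨η, hη, fun z w lam mu hz hw hlam hmu hclose => ?_⟩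
  by_contra! hsep
  have hmem : (z, w, lam, mu) ∈ far :=
    ⟨⟨mem_closedBall_zero_iff.2 hz, mem_sphere_zero_iff_norm.2 hw, hlam, hmu⟩, hsep⟩
  exact (hle _ hmem).not_gt ((pi_norm_lt_iff hη).2 fun i => hclose _ i.1.2 _ i.2.2)

lemma norm_mul_norm_sub_le {u v : ℂ} {δ : ℝ} (hu : ‖u‖ = 1) (hv : ‖v‖ = 1)
    (h1 : ‖z * u - w * v‖ ≤ δ) (h2 : ‖z * u ^ 2 - w * v ^ 2‖ ≤ δ) :
    ‖w‖ * ‖z - w‖ ≤ (2 * ‖z‖ + ‖w‖) * δ := by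
  have hsum : ‖z * u + w * v‖ ≤ ‖z‖ + ‖w‖ := (norm_add_le _ _).trans (by simp [hu, hv])
  calc ‖w‖ * ‖z - w‖ = ‖w * (z - w) * v ^ 2‖ := by simp [hv]
    _ = ‖(z * u - w * v) * (z * u + w * v) - z * (z * u ^ 2 - w * v ^ 2)‖ := by ring_nf
    _ ≤ ‖z * u - w * v‖ * ‖z * u + w * v‖ + ‖z‖ * ‖z * u ^ 2 - w * v ^ 2‖ := by
        rw [← norm_mul, ← norm_mul]
        exact norm_sub_le _ _
    _ ≤ δ * (‖z‖ + ‖w‖) + ‖z‖ * δ := by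
        gcongr
        exact (norm_nonneg _).trans h1
    _ = (2 * ‖z‖ + ‖w‖) * δ := by ring

/- The phases at `(a, b)` are unknown, so one block only shows that the rotated amplitudes are
close; the block at `(2a, 2b)`, where the phases are squared, removes the rotation. -/
lemma exists_dist_lt_of_two_blocks_close {R : ℝ} (hR : 0 ≤ R) (hw : w ≠ 0)
    (hlam₀ : lam₀ ∈ Set.Ioo 0 Real.pi) (hmu₀ : mu₀ ∈ Set.Ioo 0 Real.pi) {δ : ℝ} (hδ : 0 < δ) :
    ∃ η > 0, ∀ (z : ℂ) (lam mu : ℝ) (a b : ℕ), ‖z‖ ≤ R → lam ∈ Set.Icc 0 Real.pi →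
      mu ∈ Set.Icc 0 Real.pi →
      (∀ k ∈ ({1, 2} : Finset ℕ), ∀ i < 3, ∀ j < 3,
        |wave w lam₀ mu₀ (k * a + i) (k * b + j) - wave z lam mu (k * a + i) (k * b + j)| < η) →
      dist (z, lam, mu) (w, lam₀, mu₀) < δ := by
  have hw' : 0 < ‖w‖ := norm_pos_iff.2 hw
  have hden : 0 < 2 * R + ‖w‖ := by positivity
  set ρ := ‖w‖ * (δ / 2) / (2 * R + ‖w‖)
  obtain ⟨η, hη, hblock⟩ := exists_dist_lt_of_block_close R hw' hlam₀ hmu₀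
    (δ := min δ ρ) (by positivity)
  refine ⟨η, hη, fun z lam mu a b hz hlam hmu hclose => ?_⟩
  have hrot : ∀ k ∈ ({1, 2} : Finset ℕ),
      dist (z * phase lam mu (k * a) (k * b), lam, mu)
        (w * phase lam₀ mu₀ (k * a) (k * b), lam₀, mu₀) < min δ ρ := fun k hk =>
    hblock _ _ lam mu (by simpa [norm_phase] using hz) (by simp [norm_phase]) hlam hmu
      fun i hi j hj => by simpa only [wave_add] using hclose k hk i hi j hj
  obtain ⟨⟨-, hdlam, hdmu⟩, hrot₁, -⟩ := by
    simpa only [one_mul, Prod.dist_eq, max_lt_iff, lt_min_iff] using hrot 1 (by simp)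
  obtain ⟨-, hrot₂, -⟩ := by
    simpa only [phase_two_mul, Prod.dist_eq, max_lt_iff, lt_min_iff] using hrot 2 (by simp)
  have hmul : ‖w‖ * ‖z - w‖ ≤ ‖w‖ * (δ / 2) := calc
    ‖w‖ * ‖z - w‖ ≤ (2 * ‖z‖ + ‖w‖) * ρ :=
      norm_mul_norm_sub_le (norm_phase ..) (norm_phase ..)
        ((dist_eq_norm _ _).symm.trans_le hrot₁.le) ((dist_eq_norm _ _).symm.trans_le hrot₂.le)
    _ ≤ (2 * R + ‖w‖) * ρ := by gcongr
    _ = ‖w‖ * (δ / 2) := mul_div_cancel₀ _ hden.ne'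
  have hzw : dist z w < δ := by
    rw [dist_eq_norm]
    linarith [le_of_mul_le_mul_left hmul hw']
  exact max_lt hzw (max_lt hdlam hdmu)

end Identifiability

section Signal

/-- The cosine and sine amplitudes of a parameter, as the complex number `A + i B`. -/
def amplitude (θ : Param) : ℂ := ⟨θ.1, θ.2.1⟩

lemma signal_eq_wave (θ : Param) (t s : ℕ) :
    signal θ t s = wave (amplitude θ) θ.2.2.1 θ.2.2.2 t s :=
  (wave_eq_cos_add_sin (amplitude θ) θ.2.2.1 θ.2.2.2 t s).symm

lemma amplitude_sub (θ θ' : Param) : amplitude (θ - θ') = amplitude θ - amplitude θ' := rfl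

lemma amplitude_ne_zero {θ : Param} (h : θ.1 ≠ 0 ∨ θ.2.1 ≠ 0) : amplitude θ ≠ 0 := fun h0 =>
  h.elim (· (congrArg Complex.re h0)) (· (congrArg Complex.im h0))

lemma norm_amplitude_le (θ : Param) : ‖amplitude θ‖ ≤ 2 * ‖θ‖ := by
  rw [two_mul]
  exact (Complex.norm_le_abs_re_add_abs_im _).trans <|
    add_le_add (norm_fst_le θ) ((norm_fst_le θ.2).trans (norm_snd_le θ))

lemma dist_le_dist_amplitude (θ θ' : Param) :
    dist θ θ' ≤ dist (amplitude θ, θ.2.2) (amplitude θ', θ'.2.2) := by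
  have hre : dist θ.1 θ'.1 ≤ dist (amplitude θ) (amplitude θ') := by
    rw [dist_eq_norm (amplitude θ)]
    exact Complex.abs_re_le_norm (amplitude θ - amplitude θ')
  have him : dist θ.2.1 θ'.2.1 ≤ dist (amplitude θ) (amplitude θ') := by
    rw [dist_eq_norm (amplitude θ)]
    exact Complex.abs_im_le_norm (amplitude θ - amplitude θ')
  exact max_le (hre.trans (le_max_left _ _)) (max_le_max_right _ him)

lemma abs_signal_le (θ : Param) (t s : ℕ) : |signal θ t s| ≤ 2 * ‖θ‖ := by
  rw [signal_eq_wave]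
  calc |wave (amplitude θ) θ.2.2.1 θ.2.2.2 t s|
      ≤ ‖amplitude θ * phase θ.2.2.1 θ.2.2.2 t s‖ := Complex.abs_re_le_norm _
    _ = ‖amplitude θ‖ := by rw [norm_mul, norm_phase, mul_one]
    _ ≤ 2 * ‖θ‖ := norm_amplitude_le θ

lemma abs_signal_sub_signal_le (θ θ' : Param) (t s : ℕ) :
    |signal θ t s - signal θ' t s| ≤ (2 + 2 * ‖θ'‖ * (t + s)) * ‖θ - θ'‖ := by
  set u := phase θ.2.2.1 θ.2.2.2 t s
  set u' := phase θ'.2.2.1 θ'.2.2.2 t s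
  have hphase : ‖u - u'‖ ≤ (t + s) * ‖θ - θ'‖ := by
    have hfreq := norm_snd_le (θ - θ').2
    have hfreq' := hfreq.trans (norm_snd_le (θ - θ'))
    calc ‖u - u'‖ ≤ |θ.2.2.1 - θ'.2.2.1| * t + |θ.2.2.2 - θ'.2.2.2| * s :=
          norm_phase_sub_phase_le ..
      _ ≤ ‖θ - θ'‖ * t + ‖θ - θ'‖ * s := by
          gcongr
          · exact (norm_fst_le (θ - θ').2.2).trans hfreq'
          · exact (norm_snd_le (θ - θ').2.2).trans hfreq'
      _ = (t + s) * ‖θ - θ'‖ := by ring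
  rw [signal_eq_wave, signal_eq_wave, wave, wave, ← Complex.sub_re]
  calc |(amplitude θ * u - amplitude θ' * u').re|
      ≤ ‖amplitude θ * u - amplitude θ' * u'‖ := Complex.abs_re_le_norm _
    _ = ‖amplitude (θ - θ') * u + amplitude θ' * (u - u')‖ := by
        rw [amplitude_sub]
        ring_nf
    _ ≤ ‖amplitude (θ - θ')‖ + ‖amplitude θ'‖ * ‖u - u'‖ := by
        refine (norm_add_le _ _).trans_eq ?_
        rw [norm_mul, norm_mul, norm_phase, mul_one]
    _ ≤ 2 * ‖θ - θ'‖ + 2 * ‖θ'‖ * ((t + s) * ‖θ - θ'‖) := by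
        gcongr <;> exact norm_amplitude_le _
    _ = (2 + 2 * ‖θ'‖ * (t + s)) * ‖θ - θ'‖ := by ring

/-- The difference of the signals of `θ₀` and `θ` at a grid point: when `θ₀` is the true parameter,
the residual of `θ` is the noise plus this gap. -/
noncomputable def signalGap (θ₀ θ : Param) (i : ℕ × ℕ) : ℝ :=
  signal θ₀ i.1 i.2 - signal θ i.1 i.2

lemma abs_signalGap_le {θ₀ θ : Param} {R : ℝ} (hθ₀ : ‖θ₀‖ ≤ R) (hθ : ‖θ‖ ≤ R) (i : ℕ × ℕ) :
    |signalGap θ₀ θ i| ≤ 4 * R := by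
  refine (abs_sub _ _).trans ?_
  linarith [abs_signal_le θ₀ i.1 i.2, abs_signal_le θ i.1 i.2]

end Signal

section Separation

lemma exists_forall_notMem_of_card_mul_card_lt {α β κ : Type*} {G : Finset α} {I : Finset κ}
    {B : Finset β} {f : κ → α → β} (hf : ∀ k ∈ I, Set.InjOn (f k) G)
    (h : I.card * B.card < G.card) :
    ∃ a ∈ G, ∀ k ∈ I, f k a ∉ B := by
  classical
  by_contra! hcover
  have hsub : G ⊆ I.biUnion fun k => {a ∈ G | f k a ∈ B} := fun a ha => by
    simpa [ha] using hcover a ha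
  refine h.not_ge ((Finset.card_le_card hsub).trans (Finset.card_biUnion_le_card_mul _ _ _ ?_))
  refine fun k hk => Finset.card_le_card_of_injOn (f k) (fun a ha => (Finset.mem_filter.1 ha).2) ?_
  exact (hf k hk).mono (Finset.coe_subset.2 (Finset.filter_subset _ _))

/- There are `2 * 9 = 18` shifts of `(a, b)` to keep out of `B`, and at least `T S / 16` choices
of `(a, b)`. -/
lemma exists_two_blocks_notMem {T S : ℕ} (hT : 6 ≤ T) (hS : 6 ≤ S) {B : Finset (ℕ × ℕ)}
    (hB : 288 * B.card < T * S) :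
    ∃ a b : ℕ, ∀ k ∈ ({1, 2} : Finset ℕ), ∀ i < 3, ∀ j < 3,
      (k * a + i, k * b + j) ∈ Finset.Icc 1 T ×ˢ Finset.Icc 1 S ∧ (k * a + i, k * b + j) ∉ B := by
  let G := Finset.Icc 1 ((T - 2) / 2) ×ˢ Finset.Icc 1 ((S - 2) / 2)
  let I : Finset (ℕ × ℕ × ℕ) := {1, 2} ×ˢ Finset.range 3 ×ˢ Finset.range 3
  let shift : ℕ × ℕ × ℕ → ℕ × ℕ → ℕ × ℕ := fun k a => (k.1 * a.1 + k.2.1, k.1 * a.2 + k.2.2)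
  have hG : T * S ≤ 16 * G.card := by
    have := Nat.mul_le_mul (show T ≤ 4 * ((T - 2) / 2) by lia) (show S ≤ 4 * ((S - 2) / 2) by lia)
    simp only [G, Finset.card_product, Nat.card_Icc, Nat.add_sub_cancel]
    linarith
  have hI : I.card = 18 := rfl
  have hshift : ∀ k ∈ I, Set.InjOn (shift k) G := by
    rintro ⟨k, i, j⟩ hk ⟨a, b⟩ - ⟨a', b'⟩ - h
    have hk0 : 0 < k := by
      simp only [I, Finset.mem_product, Finset.mem_insert, Finset.mem_singleton] at hk
      lia
    simpa [shift, hk0.ne'] using h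
  obtain ⟨⟨a, b⟩, hab, hgood⟩ := exists_forall_notMem_of_card_mul_card_lt (B := B) hshift (by lia)
  refine ⟨a, b, fun k hk i hi j hj => ⟨?_, hgood (k, i, j) (by simp_all [I])⟩⟩
  simp only [G, Finset.mem_product, Finset.mem_Icc, Finset.mem_insert,
    Finset.mem_singleton] at hab hk ⊢
  rcases hk with rfl | rfl <;> lia

lemma exists_dist_lt_of_card_gap_lt {θ₀ : Param} (hamp : θ₀.1 ≠ 0 ∨ θ₀.2.1 ≠ 0)
    (hlam₀ : θ₀.2.2.1 ∈ Set.Ioo 0 Real.pi) (hmu₀ : θ₀.2.2.2 ∈ Set.Ioo 0 Real.pi)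
    {R δ : ℝ} (hR : 0 ≤ R) (hδ : 0 < δ) :
    ∃ η > 0, ∀ θ ∈ paramSpace Set.univ, ‖θ‖ ≤ R → ∀ T S : ℕ, 6 ≤ T → 6 ≤ S →
      288 * {i ∈ Finset.Icc 1 T ×ˢ Finset.Icc 1 S | η ≤ |signalGap θ₀ θ i|}.card < T * S →
      dist θ θ₀ < δ := by
  obtain ⟨η, hη, hclose⟩ := exists_dist_lt_of_two_blocks_close (R := 2 * R) (by positivity)
    (amplitude_ne_zero hamp) hlam₀ hmu₀ hδ
  refine ⟨η, hη, fun θ hΘ hθ T S hT hS hcard => (dist_le_dist_amplitude θ θ₀).trans_lt ?_⟩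
  obtain ⟨a, b, hgood⟩ := exists_two_blocks_notMem hT hS hcard
  refine hclose _ _ _ a b ((norm_amplitude_le θ).trans (by gcongr)) hΘ.2.2.1 hΘ.2.2.2
    fun k hk i hi j hj => ?_
  obtain ⟨hgrid, hnot⟩ := hgood k hk i hi j hj
  rw [← signal_eq_wave, ← signal_eq_wave]
  simpa [hgrid, signalGap] using fun h => hnot (Finset.mem_filter.2 ⟨hgrid, h⟩)

end Separation

section MeanExcess

/-- The increase of the absolute residual at noise `x` when the signal is off by `h`. -/
def excess (x h : ℝ) : ℝ := |x + h| - |x|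

lemma abs_excess_le (x h : ℝ) : |excess x h| ≤ |h| := by
  simpa [excess] using abs_abs_sub_abs_le_abs_sub (x + h) x

lemma abs_excess_sub_excess_le (x h k : ℝ) : |excess x h - excess x k| ≤ |h - k| := by
  simpa [excess] using abs_abs_sub_abs_le_abs_sub (x + h) (x + k)

lemma excess_neg (x h : ℝ) : excess x (-h) = excess (-x) h := by
  rw [excess, excess, abs_neg, ← abs_neg (x + -h), neg_add, neg_neg]

@[fun_prop]
lemma measurable_excess (h : ℝ) : Measurable (excess · h) := by
  unfold excess
  fun_prop

lemma integrable_excess (ν : Measure ℝ) [IsFiniteMeasure ν] (h : ℝ) :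
    Integrable (excess · h) ν :=
  Integrable.of_bound (by fun_prop) |h| (ae_of_all _ (abs_excess_le · h))

/-- The expected increase of the absolute residual, for noise with law `ν`, when the signal is off
by `h`; it makes sense without any moment assumption since `excess x h` is bounded by `|h|`. -/
noncomputable def meanExcess (ν : Measure ℝ) (h : ℝ) : ℝ := ∫ x, excess x h ∂ν

/-- `m` is a median of `ν`: both closed half-lines ending at `m` have mass at least `1 / 2`. -/
def IsMedian (ν : Measure ℝ) (m : ℝ) : Prop :=
  1 / 2 ≤ ν.real (Set.Iic m) ∧ 1 / 2 ≤ ν.real (Set.Ici m)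

variable {ν : Measure ℝ}

lemma isMedian_map_neg_iff {m : ℝ} : IsMedian (ν.map Neg.neg) m ↔ IsMedian ν (-m) := by
  rw [IsMedian, IsMedian, map_measureReal_apply measurable_neg measurableSet_Iic,
    map_measureReal_apply measurable_neg measurableSet_Ici]
  simp [and_comm]

lemma meanExcess_neg (h : ℝ) : meanExcess ν (-h) = meanExcess (ν.map Neg.neg) h := by
  rw [meanExcess, meanExcess, integral_map measurable_neg.aemeasurable (by fun_prop)]
  simp only [excess_neg]

variable [IsProbabilityMeasure ν]

lemma abs_meanExcess_sub_meanExcess_le (h k : ℝ) :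
    |meanExcess ν h - meanExcess ν k| ≤ |h - k| := by
  rw [meanExcess, meanExcess, ← integral_sub (integrable_excess ν h) (integrable_excess ν k),
    ← Real.norm_eq_abs]
  exact (norm_integral_le_of_norm_le_const
    (ae_of_all _ (abs_excess_sub_excess_le · h k))).trans_eq (by simp)

lemma measureReal_Ici_eq_one_sub (x : ℝ) : ν.real (Set.Ici x) = 1 - ν.real (Set.Iio x) := by
  rw [← Set.compl_Iio, probReal_compl_eq_one_sub measurableSet_Iio]

lemma isMedian_iff_eq_zero_of_cdf (hν : ∀ x, cdf ν x = 1 / 2 ↔ x = 0) (m : ℝ) :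
    IsMedian ν m ↔ m = 0 := by
  have hzero := (hν 0).2 rfl
  rw [IsMedian, measureReal_Ici_eq_one_sub, ← cdf_eq_real]
  refine ⟨fun ⟨hle, _⟩ => ?_, ?_⟩
  · rcases lt_trichotomy m 0 with hm | hm | hm
    · exact (hν m).1 (hle.antisymm' ((monotone_cdf ν hm.le).trans_eq hzero))
    · exact hm
    · have hhalf : cdf ν (m / 2) ≤ ν.real (Set.Iio m) := by
        rw [cdf_eq_real]
        exact measureReal_mono (Set.Iic_subset_Iio.2 (half_lt_self hm))
      have := (hν (m / 2)).1 <|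
        le_antisymm (by linarith) (hzero.symm.trans_le (monotone_cdf ν (half_pos hm).le))
      linarith
  · rintro rfl
    have hIio : ν.real (Set.Iio 0) ≤ cdf ν 0 := by
      rw [cdf_eq_real]
      exact measureReal_mono Set.Iio_subset_Iic_self
    exact ⟨hzero.ge, by linarith⟩

lemma mul_one_sub_indicator_le_excess {h : ℝ} (hh : 0 ≤ h) (x : ℝ) :
    h * (1 - (Set.Iio 0).indicator 1 x - (Set.Iic (-(h / 2))).indicator 1 x) ≤ excess x h := by
  have hlower := neg_le_of_abs_le ((abs_excess_le x h).trans_eq (abs_of_nonneg hh))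
  have hle := le_abs_self (x + h)
  simp only [excess, Set.indicator_apply, Set.mem_Iio, Set.mem_Iic, Pi.one_apply] at hlower ⊢
  split_ifs with hneg hfar hfar
  · linarith
  · rw [abs_of_neg hneg]
    linarith
  · linarith
  · rw [abs_of_nonneg (not_lt.1 hneg)]
    linarith

lemma mul_le_meanExcess (hν : IsMedian ν 0) {h : ℝ} (hh : 0 ≤ h) :
    h * (1 / 2 - ν.real (Set.Iic (-(h / 2)))) ≤ meanExcess ν h := by
  set A := Set.Iio (0 : ℝ)
  set B := Set.Iic (-(h / 2))
  have hA : Integrable (A.indicator (1 : ℝ → ℝ)) ν :=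
    (integrable_const 1).indicator measurableSet_Iio
  have hB : Integrable (B.indicator (1 : ℝ → ℝ)) ν :=
    (integrable_const 1).indicator measurableSet_Iic
  have hA' : Integrable (fun x => 1 - A.indicator (1 : ℝ → ℝ) x) ν := (integrable_const 1).sub hA
  have hmass : ν.real A ≤ 1 / 2 := by
    linarith [hν.2, measureReal_Ici_eq_one_sub (ν := ν) 0]
  calc h * (1 / 2 - ν.real B) ≤ h * (1 - ν.real A - ν.real B) := by gcongr; linarith
    _ = ∫ x, h * (1 - A.indicator 1 x - B.indicator 1 x) ∂ν := by
        rw [integral_const_mul, integral_sub hA' hB, integral_sub (integrable_const 1) hA,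
          integral_indicator_one measurableSet_Iio, integral_indicator_one measurableSet_Iic]
        simp [A, B]
    _ ≤ meanExcess ν h := integral_mono ((hA'.sub hB).const_mul h)
        (integrable_excess ν h) (mul_one_sub_indicator_le_excess hh)

lemma mul_le_meanExcess_neg (hν : IsMedian ν 0) {h : ℝ} (hh : 0 ≤ h) :
    h * (1 / 2 - ν.real (Set.Ici (h / 2))) ≤ meanExcess ν (-h) := by
  have : IsProbabilityMeasure (ν.map Neg.neg) :=
    Measure.isProbabilityMeasure_map measurable_neg.aemeasurable
  have hle := mul_le_meanExcess (isMedian_map_neg_iff.2 (by rwa [neg_zero])) hh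
  rw [map_measureReal_apply measurable_neg measurableSet_Iic, ← meanExcess_neg] at hle
  simpa using hle

lemma measureReal_lt_half_of_pos (hν : ∀ m, IsMedian ν m ↔ m = 0) {x : ℝ} (hx : 0 < x) :
    ν.real (Set.Iic (-x)) < 1 / 2 ∧ ν.real (Set.Ici x) < 1 / 2 := by
  have hzero := (hν 0).2 rfl
  constructor
  · by_contra! hmass
    refine (neg_neg_of_pos hx).ne ((hν _).1 ⟨hmass, hzero.2.trans (measureReal_mono ?_)⟩)
    exact Set.Ici_subset_Ici.2 (neg_nonpos.2 hx.le)
  · by_contra! hmass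
    refine hx.ne' ((hν _).1 ⟨hzero.1.trans (measureReal_mono ?_), hmass⟩)
    exact Set.Iic_subset_Iic.2 hx.le

lemma exists_meanExcess_lower_bound (hν : ∀ m, IsMedian ν m ↔ m = 0) {η : ℝ} (hη : 0 < η) :
    ∃ p > 0, ∀ h, η ≤ |h| → p ≤ meanExcess ν h := by
  have hzero := (hν 0).2 rfl
  have htail := measureReal_lt_half_of_pos hν (half_pos hη)
  refine ⟨η * (1 / 2 - max (ν.real (Set.Iic (-(η / 2)))) (ν.real (Set.Ici (η / 2)))),
    mul_pos hη (sub_pos.2 (max_lt htail.1 htail.2)), fun h hh => ?_⟩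
  have hpos := (sub_pos.2 (max_lt htail.1 htail.2)).le
  rcases le_abs.1 hh with hle | hle
  · refine le_trans (mul_le_mul hle ?_ hpos (hη.le.trans hle))
      (mul_le_meanExcess hzero (hη.le.trans hle))
    gcongr
    exact (measureReal_mono (Set.Iic_subset_Iic.2 (by linarith))).trans (le_max_left _ _)
  · refine le_trans (mul_le_mul hle ?_ hpos (hη.le.trans hle)) <|
      (mul_le_meanExcess_neg hzero (hη.le.trans hle)).trans_eq (by rw [neg_neg])
    gcongr
    exact (measureReal_mono (Set.Ici_subset_Ici.2 (by linarith))).trans (le_max_right _ _)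

lemma meanExcess_nonneg (hν : IsMedian ν 0) (h : ℝ) : 0 ≤ meanExcess ν h := by
  rcases lt_trichotomy h 0 with hh | rfl | hh
  · have hmass : ν.real (Set.Ici (-h / 2)) ≤ 1 - ν.real (Set.Iic 0) := by
      rw [← probReal_compl_eq_one_sub measurableSet_Iic, Set.compl_Iic]
      exact measureReal_mono (Set.Ici_subset_Ioi.2 (by linarith))
    have hle := mul_le_meanExcess_neg hν (neg_pos.2 hh).le
    rw [neg_neg] at hle
    exact (mul_nonneg (neg_pos.2 hh).le (by linarith [hν.1])).trans hle
  · simp [meanExcess, excess]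
  · have hmass : ν.real (Set.Iic (-(h / 2))) ≤ 1 - ν.real (Set.Ici 0) := by
      rw [← probReal_compl_eq_one_sub measurableSet_Ici, Set.compl_Ici]
      exact measureReal_mono (Set.Iic_subset_Iio.2 (by linarith))
    exact (mul_nonneg hh.le (by linarith [hν.2])).trans (mul_le_meanExcess hν hh.le)

end MeanExcess

section Concentration

lemma measureReal_sum_integral_sub_ge_le {Ω ι : Type*} [MeasurableSpace Ω] {P : Measure Ω}
    [IsProbabilityMeasure P] {X : ι → Ω → ℝ} {s : Finset ι} (hindep : iIndepFun X P)
    (hmeas : ∀ i ∈ s, AEMeasurable (X i) P) {M δ : ℝ} (hM : 0 < M)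
    (hbound : ∀ i ∈ s, ∀ᵐ ω ∂P, |X i ω| ≤ M) (hδ : 0 ≤ δ) :
    P.real {ω | δ * s.card ≤ ∑ i ∈ s, (P[X i] - X i ω)} ≤
      Real.exp (-(δ ^ 2 / (2 * M ^ 2)) * s.card) := by
  have hsub : ∀ i ∈ s, HasSubgaussianMGF (fun ω => P[X i] - X i ω) ((‖M - -M‖₊ / 2) ^ 2) P := by
    intro i hi
    have hneg := hasSubgaussianMGF_of_mem_Icc (hmeas i hi).neg (a := -M) (b := M)
      ((hbound i hi).mono fun ω hω => by rwa [Pi.neg_apply, Set.mem_Icc, ← abs_le, abs_neg])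
    refine hneg.congr (ae_of_all _ fun ω => ?_)
    simp only [Pi.neg_apply, integral_neg]
    ring
  have hindep' : iIndepFun (fun i ω => P[X i] - X i ω) P :=
    hindep.comp (fun i x => (∫ ω, X i ω ∂P) - x) fun i => by fun_prop
  refine (HasSubgaussianMGF.measure_sum_ge_le_of_iIndepFun hindep' hsub (by positivity)).trans_eq ?_
  have hc : ‖M - -M‖ / 2 = M := by
    rw [sub_neg_eq_add, Real.norm_of_nonneg (by positivity)]
    ring
  push_cast
  rw [hc, Finset.sum_const, nsmul_eq_mul]
  rcases s.eq_empty_or_nonempty with rfl | hs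
  · simp
  · have : (0 : ℝ) < s.card := by exact_mod_cast hs.card_pos
    congr 1
    field_simp

lemma ae_eventually_cofinite_forall_notMem {Ω ι κ : Type*} [MeasurableSpace Ω] [Countable ι]
    {P : Measure Ω} {N : ι → Finset κ} {E : ι → κ → Set Ω} (h : ∑' i, ∑ k ∈ N i, P (E i k) ≠ ⊤) :
    ∀ᵐ ω ∂P, ∀ᶠ i in cofinite, ∀ k ∈ N i, ω ∉ E i k := by
  have hunion := ae_finite_setOfPred_mem (ne_top_of_le_ne_top h
    (ENNReal.tsum_le_tsum fun i => measure_biUnion_finset_le (μ := P) (N i) (E i)))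
  filter_upwards [hunion] with ω hω
  filter_upwards [hω.compl_mem_cofinite] with i hi k hk hmem
  exact hi (Set.mem_biUnion hk hmem)

lemma summable_pow_mul_exp_neg (k : ℕ) {c : ℝ} (hc : 0 < c) :
    Summable fun n : ℕ+ × ℕ+ =>
      ((n.1 : ℝ) * n.2) ^ k * Real.exp (-c * ((n.1 : ℝ) * n.2)) := by
  have hsq : Summable fun n : ℕ+ => 1 / ((n : ℕ) : ℝ) ^ 2 :=
    (Real.summable_one_div_nat_pow.2 one_lt_two).comp_injective PNat.coe_injective
  have hprod := (hsq.mul_of_nonneg hsq (fun _ => by positivity) (fun _ => by positivity)).mul_left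
    ((k + 2).factorial / c ^ (k + 2))
  refine hprod.of_nonneg_of_le (fun _ => by positivity) fun n => ?_
  have hexp := Real.pow_div_factorial_le_exp (x := c * ((n.1 : ℝ) * n.2)) (by positivity) (k + 2)
  rw [neg_mul, Real.exp_neg]
  calc ((n.1 : ℝ) * n.2) ^ k * (Real.exp (c * ((n.1 : ℝ) * n.2)))⁻¹
      ≤ ((n.1 : ℝ) * n.2) ^ k * ((c * ((n.1 : ℝ) * n.2)) ^ (k + 2) / (k + 2).factorial)⁻¹ := by
        gcongr
    _ = _ := by
        field_simp
        ring

end Concentration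

section Net

open Metric
open scoped NNReal

lemma isCover_prod {X Y : Type*} [PseudoEMetricSpace X] [PseudoEMetricSpace Y] {r : ℝ≥0}
    {s M : Set X} {t N : Set Y} (hs : IsCover r s M) (ht : IsCover r t N) :
    IsCover r (s ×ˢ t) (M ×ˢ N) := by
  rintro ⟨x, y⟩ ⟨hx, hy⟩
  obtain ⟨x', hx', hxx'⟩ := hs hx
  obtain ⟨y', hy', hyy'⟩ := ht hy
  exact ⟨(x', y'), ⟨hx', hy'⟩, (max_le hxx' hyy' : edist (x, y) (x', y') ≤ r)⟩

lemma exists_isCover_closedBall_real (R : ℕ) {n : ℕ} (hn : n ≠ 0) :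
    ∃ N : Finset ℝ, N.card ≤ 2 * R * n + 1 ∧ (N : Set ℝ) ⊆ closedBall 0 R ∧
      IsCover (1 / n : ℝ≥0) (closedBall 0 R) (N : Set ℝ) := by
  classical
  have hn' : (0 : ℝ) < n := by positivity
  refine ⟨(Finset.Icc (-(R * n : ℤ)) (R * n)).image fun k : ℤ => (k : ℝ) / n, ?_, ?_, ?_⟩
  · refine Finset.card_image_le.trans ?_
    rw [Int.card_Icc]
    lia
  · simp only [Finset.coe_image, Set.image_subset_iff]
    intro k hk
    rw [Finset.mem_coe, Finset.mem_Icc, ← abs_le] at hk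
    rw [Set.mem_preimage, mem_closedBall_zero_iff, Real.norm_eq_abs, abs_div, Nat.abs_cast,
      div_le_iff₀ hn']
    exact_mod_cast hk
  · intro x hx
    rw [mem_closedBall_zero_iff, Real.norm_eq_abs, abs_le] at hx
    have hlower : -(R * n : ℤ) ≤ ⌊x * n⌋ := Int.le_floor.2 (by push_cast; nlinarith)
    have hupper : ⌊x * n⌋ ≤ (R * n : ℤ) :=
      Int.floor_le_iff.2 (by push_cast; nlinarith)
    refine ⟨⌊x * n⌋ / n, by simpa using ⟨_, ⟨hlower, hupper⟩, rfl⟩, ?_⟩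
    have hfract : x - ⌊x * n⌋ / n = Int.fract (x * n) / n := by
      rw [Int.fract]
      field_simp
    change edist x _ ≤ _
    rw [edist_le_coe, ← NNReal.coe_le_coe, coe_nndist, Real.dist_eq, hfract,
      abs_of_nonneg (by positivity)]
    push_cast
    gcongr
    exact (Int.fract_lt_one _).le

lemma exists_isCover_closedBall_param (R : ℕ) {n : ℕ} (hn : n ≠ 0) :
    ∃ N : Finset Param, N.card ≤ (2 * R * n + 1) ^ 4 ∧ (N : Set Param) ⊆ closedBall 0 R ∧
      IsCover (1 / n : ℝ≥0) (closedBall 0 R) (N : Set Param) := by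
  obtain ⟨N, hcard, hsub, hcover⟩ := exists_isCover_closedBall_real R hn
  have hball : (closedBall 0 R : Set Param) =
      closedBall 0 R ×ˢ closedBall 0 R ×ˢ closedBall 0 R ×ˢ closedBall 0 R := by
    simp only [closedBall_prod_same, Prod.mk_zero_zero]
  refine ⟨N ×ˢ N ×ˢ N ×ˢ N, ?_, ?_, ?_⟩
  · simp only [Finset.card_product]
    calc N.card * (N.card * (N.card * N.card)) = N.card ^ 4 := by ring
      _ ≤ (2 * R * n + 1) ^ 4 := by gcongr
  all_goals rw [hball]; push_cast
  · gcongr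
  · exact isCover_prod hcover (isCover_prod hcover (isCover_prod hcover hcover))

end Net

section UniformLaw

/-- The shortfall, over the `T × S` grid with noise values `x`, of the total excess absolute
residual at `θ` below its expectation, when `θ₀` is the true parameter. -/
noncomputable def excessDeficit (ν : Measure ℝ) (x : ℕ → ℕ → ℝ) (θ₀ θ : Param) (T S : ℕ) : ℝ :=
  ∑ i ∈ Finset.Icc 1 T ×ˢ Finset.Icc 1 S,
    (meanExcess ν (signalGap θ₀ θ i) - excess (x i.1 i.2) (signalGap θ₀ θ i))

lemma sum_pnat_Icc_product {M : Type*} [AddCommMonoid M] (T S : ℕ+) (f : ℕ × ℕ → M) :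
    ∑ i ∈ Finset.Icc 1 T ×ˢ Finset.Icc 1 S, f (i.1, i.2) =
      ∑ i ∈ Finset.Icc 1 (T : ℕ) ×ˢ Finset.Icc 1 (S : ℕ), f i := by
  have hIcc (n : ℕ+) (g : ℕ → M) :
      ∑ t ∈ Finset.Icc 1 n, g t = ∑ t ∈ Finset.Icc 1 (n : ℕ), g t := by
    rw [← PNat.one_coe, ← PNat.map_subtype_embedding_Icc]
    exact (Finset.sum_map (Finset.Icc 1 n) ⟨PNat.val, PNat.coe_injective⟩ g).symm
  simp only [Finset.sum_product, ← hIcc]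

variable {ν : Measure ℝ} {θ₀ θ θ' : Param} {R : ℝ}

lemma excessDeficit_le_add [IsProbabilityMeasure ν] (x : ℕ → ℕ → ℝ) (hθ' : ‖θ'‖ ≤ R) {T S : ℕ}
    (hT : 1 ≤ T) (hS : 1 ≤ S) :
    excessDeficit ν x θ₀ θ T S ≤
      excessDeficit ν x θ₀ θ' T S + (4 + 8 * R) * (T * S : ℝ) ^ 2 * dist θ θ' := by
  have hR : 0 ≤ R := (norm_nonneg _).trans hθ'
  have hT' : (1 : ℝ) ≤ T := by exact_mod_cast hT
  have hS' : (1 : ℝ) ≤ S := by exact_mod_cast hS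
  have hgap : ∀ i ∈ Finset.Icc 1 T ×ˢ Finset.Icc 1 S,
      |signalGap θ₀ θ i - signalGap θ₀ θ' i| ≤ (2 + 4 * R) * (T * S) * dist θ θ' := by
    intro i hi
    simp only [Finset.mem_product, Finset.mem_Icc] at hi
    rw [signalGap, signalGap, sub_sub_sub_cancel_left, abs_sub_comm, dist_eq_norm]
    refine (abs_signal_sub_signal_le θ θ' i.1 i.2).trans ?_
    gcongr
    calc 2 + 2 * ‖θ'‖ * (i.1 + i.2) ≤ 2 + 2 * R * (T + S) := by
          gcongr <;> lia
      _ ≤ (2 + 4 * R) * (T * S) := by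
          nlinarith [mul_nonneg (sub_nonneg.2 hT') (sub_nonneg.2 hS')]
  have hterm : ∀ i ∈ Finset.Icc 1 T ×ˢ Finset.Icc 1 S,
      meanExcess ν (signalGap θ₀ θ i) - excess (x i.1 i.2) (signalGap θ₀ θ i) ≤
        (meanExcess ν (signalGap θ₀ θ' i) - excess (x i.1 i.2) (signalGap θ₀ θ' i)) +
          2 * ((2 + 4 * R) * (T * S) * dist θ θ') := by
    intro i hi
    have hmean := (le_abs_self _).trans
      ((abs_meanExcess_sub_meanExcess_le (ν := ν) _ _).trans (hgap i hi))
    have hexcess := (neg_abs_le _).trans' <| neg_le_neg <|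
      (abs_excess_sub_excess_le (x i.1 i.2) _ _).trans (hgap i hi)
    linarith
  refine (Finset.sum_le_sum hterm).trans_eq ?_
  rw [Finset.sum_add_distrib, Finset.sum_const, Finset.card_product, Nat.card_Icc, Nat.card_Icc,
    Nat.add_sub_cancel, Nat.add_sub_cancel, nsmul_eq_mul, excessDeficit]
  push_cast
  ring

variable {Ω : Type*} [MeasurableSpace Ω] {P : Measure Ω} [IsProbabilityMeasure P]
  {ε : ℕ → ℕ → Ω → ℝ}

lemma measureReal_excessDeficit_ge_le (hindep : iIndepFun (fun p : ℕ+ × ℕ+ => ε p.1 p.2) P)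
    (hlaw : ∀ t s : ℕ+, HasLaw (ε t s) ν P) (hR : 0 < R) (hθ₀ : ‖θ₀‖ ≤ R) (hθ : ‖θ‖ ≤ R)
    {δ : ℝ} (hδ : 0 ≤ δ) (T S : ℕ+) :
    P.real {ω | δ * (T * S) ≤ excessDeficit ν (fun t s => ε t s ω) θ₀ θ T S} ≤
      Real.exp (-(δ ^ 2 / (2 * (4 * R) ^ 2)) * (T * S)) := by
  let X : ℕ+ × ℕ+ → Ω → ℝ := fun i ω => excess (ε i.1 i.2 ω) (signalGap θ₀ θ (i.1, i.2))
  have hX : iIndepFun X P :=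
    hindep.comp (fun i x => excess x (signalGap θ₀ θ (i.1, i.2))) fun i => by fun_prop
  have hmean : ∀ i, P[X i] = meanExcess ν (signalGap θ₀ θ (i.1, i.2)) := fun i =>
    (hlaw i.1 i.2).integral_comp (measurable_excess _).aestronglyMeasurable
  have hHoeffding := measureReal_sum_integral_sub_ge_le (M := 4 * R)
    (s := Finset.Icc 1 T ×ˢ Finset.Icc 1 S) hX
    (fun i _ => (measurable_excess _).comp_aemeasurable (hlaw i.1 i.2).aemeasurable) (by positivity)
    (fun i _ => ae_of_all _ fun ω => (abs_excess_le _ _).trans (abs_signalGap_le hθ₀ hθ _)) hδ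
  have hsum : ∀ ω, excessDeficit ν (fun t s => ε t s ω) θ₀ θ T S =
      ∑ i ∈ Finset.Icc 1 T ×ˢ Finset.Icc 1 S, (P[X i] - X i ω) := fun ω => by
    simp only [hmean]
    exact (sum_pnat_Icc_product T S fun i =>
      meanExcess ν (signalGap θ₀ θ i) - excess (ε i.1 i.2 ω) (signalGap θ₀ θ i)).symm
  simpa only [hsum, Finset.card_product, PNat.card_Icc, PNat.one_coe, Nat.add_sub_cancel,
    Nat.cast_mul] using hHoeffding

lemma ae_eventually_forall_mem_excessDeficit_lt
    (hindep : iIndepFun (fun p : ℕ+ × ℕ+ => ε p.1 p.2) P)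
    (hlaw : ∀ t s : ℕ+, HasLaw (ε t s) ν P) (hR : 0 < R) (hθ₀ : ‖θ₀‖ ≤ R)
    {N : ℕ+ × ℕ+ → Finset Param} (hN : ∀ n, ∀ θ ∈ N n, ‖θ‖ ≤ R) {C k : ℕ}
    (hcard : ∀ n, (N n).card ≤ C * (n.1 * n.2) ^ k) {δ : ℝ} (hδ : 0 < δ) :
    ∀ᵐ ω ∂P, ∀ᶠ n : ℕ+ × ℕ+ in cofinite, ∀ θ ∈ N n,
      excessDeficit ν (fun t s => ε t s ω) θ₀ θ n.1 n.2 < δ * (n.1 * n.2) := by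
  let E : ℕ+ × ℕ+ → Param → Set Ω := fun n θ =>
    {ω | δ * (n.1 * n.2) ≤ excessDeficit ν (fun t s => ε t s ω) θ₀ θ n.1 n.2}
  set c := δ ^ 2 / (2 * (4 * R) ^ 2)
  have hE : ∀ n, ∑ θ ∈ N n, P (E n θ) ≤ ENNReal.ofReal
      (C * (((n.1 : ℝ) * n.2) ^ k * Real.exp (-c * ((n.1 : ℝ) * n.2)))) := by
    intro n
    have hcard' : ((N n).card : ℝ) ≤ C * ((n.1 : ℝ) * n.2) ^ k := by exact_mod_cast hcard n
    calc ∑ θ ∈ N n, P (E n θ)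
        ≤ ∑ _ ∈ N n, ENNReal.ofReal (Real.exp (-c * ((n.1 : ℝ) * n.2))) := by
          gcongr with θ hθ
          rw [← ofReal_measureReal]
          exact ENNReal.ofReal_le_ofReal (measureReal_excessDeficit_ge_le hindep hlaw hR hθ₀
            (hN n θ hθ) hδ.le n.1 n.2)
      _ = ENNReal.ofReal ((N n).card * Real.exp (-c * ((n.1 : ℝ) * n.2))) := by
          rw [Finset.sum_const, nsmul_eq_mul, ENNReal.ofReal_mul (by positivity),
            ENNReal.ofReal_natCast]
      _ ≤ _ := by
          rw [← mul_assoc (C : ℝ)]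
          gcongr
  have hsum := ((summable_pow_mul_exp_neg k (c := c) (by positivity)).mul_left
    (C : ℝ)).tsum_ofReal_ne_top
  have hBC := ae_eventually_cofinite_forall_notMem
    (ne_top_of_le_ne_top hsum (ENNReal.tsum_le_tsum hE))
  filter_upwards [hBC] with ω hω
  filter_upwards [hω] with n hn θ hθ using not_le.1 (hn θ hθ)

lemma ae_eventually_forall_excessDeficit_le [IsProbabilityMeasure ν] {R : ℕ}
    (hindep : iIndepFun (fun p : ℕ+ × ℕ+ => ε p.1 p.2) P)
    (hlaw : ∀ t s : ℕ+, HasLaw (ε t s) ν P) (hR : 0 < R) (hθ₀ : ‖θ₀‖ ≤ R)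
    {δ : ℝ} (hδ : 0 < δ) :
    ∀ᵐ ω ∂P, ∀ᶠ n : ℕ+ × ℕ+ in cofinite, ∀ θ : Param, ‖θ‖ ≤ R →
      excessDeficit ν (fun t s => ε t s ω) θ₀ θ n.1 n.2 ≤ δ * (n.1 * n.2) := by
  obtain ⟨m, hm⟩ := exists_nat_gt ((4 + 8 * R) / (δ / 2))
  have hm0 : (0 : ℝ) < m := hm.trans_le' (by positivity)
  have hmesh : (4 + 8 * R : ℝ) / m ≤ δ / 2 := ((div_lt_comm₀ (by positivity) hm0).1 hm).le
  have hm0' : 0 < m := by exact_mod_cast hm0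
  choose N hcard hN hcover using fun n : ℕ+ × ℕ+ =>
    exists_isCover_closedBall_param R (n := m * (n.1 * n.2)) (by positivity)
  have hcard' : ∀ n, (N n).card ≤ (3 * R * m) ^ 4 * (n.1 * n.2) ^ 4 := by
    intro n
    have hone : 1 ≤ R * (m * (n.1 * n.2)) := Nat.one_le_iff_ne_zero.2 (by positivity)
    refine (hcard n).trans ?_
    rw [← mul_pow]
    gcongr
    linarith
  have hnet := ae_eventually_forall_mem_excessDeficit_lt hindep hlaw (Nat.cast_pos.2 hR) hθ₀
    (fun n θ hθ => mem_closedBall_zero_iff.1 (hN n hθ)) hcard' (half_pos hδ)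
  filter_upwards [hnet] with ω hω
  filter_upwards [hω] with n hn θ hθ
  obtain ⟨θ', hθ', hdist⟩ := hcover n (mem_closedBall_zero_iff.2 hθ)
  replace hdist : dist θ θ' ≤ 1 / (m * (n.1 * n.2)) := by
    have := edist_le_coe.1 hdist
    rw [← NNReal.coe_le_coe] at this
    exact_mod_cast this
  calc excessDeficit ν (fun t s => ε t s ω) θ₀ θ n.1 n.2
      ≤ δ / 2 * (n.1 * n.2) + (4 + 8 * R) * (n.1 * n.2) ^ 2 * (1 / (m * (n.1 * n.2))) := by
        refine (excessDeficit_le_add _ (mem_closedBall_zero_iff.1 (hN n hθ')) n.1.pos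
          n.2.pos).trans ?_
        gcongr
        exact (hn θ' hθ').le
    _ = δ / 2 * (n.1 * n.2) + (4 + 8 * R) / m * (n.1 * n.2) := by
        field_simp
    _ ≤ δ / 2 * (n.1 * n.2) + δ / 2 * (n.1 * n.2) := by
        grw [hmesh]
    _ = δ * (n.1 * n.2) := by ring

end UniformLaw

section Consistency

lemma card_filter_mul_le_sum {ι : Type*} (s : Finset ι) (f : ι → ℝ) (q : ι → Prop)
    [DecidablePred q] {p : ℝ} (hf : ∀ i ∈ s, 0 ≤ f i) (hq : ∀ i ∈ s, q i → p ≤ f i) :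
    (s.filter q).card * p ≤ ∑ i ∈ s, f i := by
  rw [← nsmul_eq_mul]
  exact (Finset.card_nsmul_le_sum _ f p fun i hi => (Finset.mem_filter.1 hi).elim (hq i)).trans
    (Finset.sum_le_sum_of_subset_of_nonneg (Finset.filter_subset q s) fun i hi _ => hf i hi)

lemma meanAbsResidual_sub_meanAbsResidual (x : ℕ → ℕ → ℝ) (θ₀ θ : Param) (T S : ℕ) :
    meanAbsResidual (fun t s => signal θ₀ t s + x t s) T S θ -
        meanAbsResidual (fun t s => signal θ₀ t s + x t s) T S θ₀ =
      1 / (T * S) * ∑ i ∈ Finset.Icc 1 T ×ˢ Finset.Icc 1 S,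
        excess (x i.1 i.2) (signalGap θ₀ θ i) := by
  simp only [meanAbsResidual, ← mul_sub, ← Finset.sum_sub_distrib, Finset.sum_product, excess,
    signalGap, add_sub_cancel_left, add_sub_right_comm, add_comm (x _ _)]

section Estimator

variable {Ω : Type*} {Θ : Set Param} {θ₀ : Param} {ε : ℕ → ℕ → Ω → ℝ} {θhat : ℕ → ℕ → Ω → Param}

lemma IsLADEstimator.sum_excess_nonpos (hθ : IsLADEstimator Θ (obs θ₀ ε) θhat) (hθ₀ : θ₀ ∈ Θ)
    {T S : ℕ} (hT : 1 ≤ T) (hS : 1 ≤ S) (ω : Ω) :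
    ∑ i ∈ Finset.Icc 1 T ×ˢ Finset.Icc 1 S,
      excess (ε i.1 i.2 ω) (signalGap θ₀ (θhat T S ω) i) ≤ 0 := by
  have hmin := sub_nonpos.2 (isMinOn_iff.1 (hθ T S hT hS ω).2 θ₀ hθ₀)
  simp only [obs] at hmin
  rw [meanAbsResidual_sub_meanAbsResidual fun t s => ε t s ω] at hmin
  exact nonpos_of_mul_nonpos_right hmin (by positivity)

lemma IsLADEstimator.card_gap_mul_le_excessDeficit {ν : Measure ℝ}
    (hθ : IsLADEstimator Θ (obs θ₀ ε) θhat) (hθ₀ : θ₀ ∈ Θ) {η p : ℝ}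
    (hnonneg : ∀ h, 0 ≤ meanExcess ν h) (hlower : ∀ h, η ≤ |h| → p ≤ meanExcess ν h)
    {T S : ℕ} (hT : 1 ≤ T) (hS : 1 ≤ S) (ω : Ω) :
    {i ∈ Finset.Icc 1 T ×ˢ Finset.Icc 1 S | η ≤ |signalGap θ₀ (θhat T S ω) i|}.card * p ≤
      excessDeficit ν (fun t s => ε t s ω) θ₀ (θhat T S ω) T S := by
  refine (card_filter_mul_le_sum _ (fun i => meanExcess ν (signalGap θ₀ (θhat T S ω) i)) _
    (fun i _ => hnonneg _) fun i _ => hlower _).trans ?_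
  rw [excessDeficit, Finset.sum_sub_distrib]
  linarith [hθ.sum_excess_nonpos hθ₀ hT hS ω]

variable [MeasurableSpace Ω] {P : Measure Ω} [IsProbabilityMeasure P] {ν : Measure ℝ}
  [IsProbabilityMeasure ν]

lemma IsLADEstimator.ae_eventually_dist_lt (hθ : IsLADEstimator Θ (obs θ₀ ε) θhat)
    (hΘ : Bornology.IsBounded Θ) (hΘsub : Θ ⊆ paramSpace Set.univ) (hθ₀ : θ₀ ∈ Θ)
    (hlam₀ : θ₀.2.2.1 ∈ Set.Ioo 0 Real.pi) (hmu₀ : θ₀.2.2.2 ∈ Set.Ioo 0 Real.pi)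
    (hamp : θ₀.1 ≠ 0 ∨ θ₀.2.1 ≠ 0) (hindep : iIndepFun (fun p : ℕ+ × ℕ+ => ε p.1 p.2) P)
    (hlaw : ∀ t s : ℕ+, HasLaw (ε t s) ν P) (hν : ∀ m, IsMedian ν m ↔ m = 0)
    {δ : ℝ} (hδ : 0 < δ) :
    ∀ᵐ ω ∂P, ∀ᶠ n : ℕ+ × ℕ+ in cofinite, 6 ≤ (n.1 : ℕ) → 6 ≤ (n.2 : ℕ) →
      dist (θhat n.1 n.2 ω) θ₀ < δ := by
  obtain ⟨C, hC⟩ := hΘ.exists_norm_le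
  obtain ⟨R, hR⟩ := exists_nat_gt (max C 0)
  have hnorm : ∀ θ ∈ Θ, ‖θ‖ ≤ R := fun θ hθ =>
    (hC θ hθ).trans ((le_max_left _ _).trans hR.le)
  have hRpos : 0 < R := by exact_mod_cast (le_max_right _ _).trans_lt hR
  obtain ⟨η, hη, hsep⟩ := exists_dist_lt_of_card_gap_lt hamp hlam₀ hmu₀ R.cast_nonneg hδ
  obtain ⟨p, hp, hlower⟩ := exists_meanExcess_lower_bound hν hη
  filter_upwards [ae_eventually_forall_excessDeficit_le hindep hlaw hRpos (hnorm _ hθ₀)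
    (δ := p / 576) (by positivity)] with ω hω
  filter_upwards [hω] with n hdeficit hT hS
  have hmem := (hθ n.1 n.2 n.1.pos n.2.pos ω).1
  refine hsep _ (hΘsub hmem) (hnorm _ hmem) n.1 n.2 hT hS ?_
  have hcount := (hθ.card_gap_mul_le_excessDeficit hθ₀ (meanExcess_nonneg ((hν 0).2 rfl)) hlower
    n.1.pos n.2.pos ω).trans (hdeficit _ (hnorm _ hmem))
  have hgrid : 0 < p * ((n.1 : ℝ) * n.2) := by positivity
  rw [← Nat.cast_lt (α := ℝ), ← mul_lt_mul_iff_left₀ hp]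
  push_cast
  linarith

end Estimator

lemma eventually_comap_min_of_cofinite {q : ℕ → ℕ → Prop}
    (h : ∀ᶠ n : ℕ+ × ℕ+ in cofinite, q n.1 n.2) :
    ∀ᶠ n in comap (fun n : ℕ × ℕ => min n.1 n.2) atTop, q n.1 n.2 := by
  have hfst : Tendsto Prod.fst (comap (fun n : ℕ × ℕ => min n.1 n.2) atTop) atTop :=
    tendsto_atTop_mono (fun n => min_le_left n.1 n.2) tendsto_comap
  have hsnd : Tendsto Prod.snd (comap (fun n : ℕ × ℕ => min n.1 n.2) atTop) atTop :=
    tendsto_atTop_mono (fun n => min_le_right n.1 n.2) tendsto_comap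
  have hPNat : Tendsto Nat.toPNat' atTop atTop := by
    refine tendsto_atTop.2 fun k => ?_
    filter_upwards [eventually_ge_atTop (k : ℕ)] with n hn
    rwa [← PNat.coe_le_coe, PNat.toPNat'_coe (k.pos.trans_le hn)]
  have hpair := (hPNat.comp hfst).prodMk (hPNat.comp hsnd)
  rw [prod_atTop_atTop_eq] at hpair
  filter_upwards [hpair.eventually (atTop_le_cofinite h), hfst.eventually_gt_atTop 0,
    hsnd.eventually_gt_atTop 0] with n hn hT hS
  simpa only [Function.comp_apply, PNat.toPNat'_coe hT, PNat.toPNat'_coe hS] using hn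

lemma paramSpace_mono {K L : Set ℝ} (h : K ⊆ L) : paramSpace K ⊆ paramSpace L :=
  Set.prod_mono h (Set.prod_mono_left h)

lemma isBounded_paramSpace {K : Set ℝ} (hK : Bornology.IsBounded K) :
    Bornology.IsBounded (paramSpace K) :=
  hK.prod (hK.prod ((Metric.isBounded_Icc _ _).prod (Metric.isBounded_Icc _ _)))

lemma mem_Ioo_of_mem_interior_paramSpace {K : Set ℝ} {θ : Param}
    (h : θ ∈ interior (paramSpace K)) :
    θ.2.2.1 ∈ Set.Ioo 0 Real.pi ∧ θ.2.2.2 ∈ Set.Ioo 0 Real.pi := by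
  rw [paramSpace, interior_prod_eq, interior_prod_eq, interior_prod_eq, interior_Icc] at h
  exact h.2.2

lemma NoiseAssumption.hasLaw {Ω : Type*} [MeasurableSpace Ω] {P : Measure Ω}
    {ε : ℕ → ℕ → Ω → ℝ} {g : ℝ → ℝ} (hε : NoiseAssumption P ε g) (t s : ℕ+) :
    HasLaw (ε t s) (volume.withDensity fun x => ENNReal.ofReal (g x)) P :=
  ⟨(hε.measurable t s).aemeasurable, hε.law t s⟩

lemma NoiseAssumption.isMedian_iff {Ω : Type*} [MeasurableSpace Ω] {P : Measure Ω}
    [IsProbabilityMeasure P] {ε : ℕ → ℕ → Ω → ℝ} {g : ℝ → ℝ} (hε : NoiseAssumption P ε g) (m : ℝ) :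
    IsMedian (volume.withDensity fun x => ENNReal.ofReal (g x)) m ↔ m = 0 := by
  have : IsProbabilityMeasure (volume.withDensity fun x => ENNReal.ofReal (g x)) :=
    (hε.hasLaw 1 1).isProbabilityMeasure_iff.1 inferInstance
  exact isMedian_iff_eq_zero_of_cdf (hε.law 1 1 ▸ hε.unique_median 1 1) m

end Consistency

end LADSinusoid

open LADSinusoid in
theorem theorem1_general {Ω : Type*} [MeasurableSpace Ω] (P : Measure Ω) [IsProbabilityMeasure P]
    {Θ : Set Param} (hΘ : Bornology.IsBounded Θ) (hΘsub : Θ ⊆ paramSpace Set.univ)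
    {θ₀ : Param} (hθ₀ : θ₀ ∈ Θ) (hlam₀ : θ₀.2.2.1 ∈ Set.Ioo 0 Real.pi)
    (hmu₀ : θ₀.2.2.2 ∈ Set.Ioo 0 Real.pi) (hamp : θ₀.1 ≠ 0 ∨ θ₀.2.1 ≠ 0)
    {ε : ℕ → ℕ → Ω → ℝ} {ν : Measure ℝ} (hindep : iIndepFun (fun p : ℕ+ × ℕ+ => ε p.1 p.2) P)
    (hlaw : ∀ t s : ℕ+, HasLaw (ε t s) ν P) (hν : ∀ m, IsMedian ν m ↔ m = 0)
    {θhat : ℕ → ℕ → Ω → Param} (hθ : IsLADEstimator Θ (obs θ₀ ε) θhat) :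
    ∀ᵐ ω ∂P, Tendsto (fun n : ℕ × ℕ => θhat n.1 n.2 ω)
      (comap (fun n : ℕ × ℕ => min n.1 n.2) atTop) (𝓝 θ₀) := by
  have : IsProbabilityMeasure ν := (hlaw 1 1).isProbabilityMeasure_iff.1 inferInstance
  have hsix : ∀ᶠ n in comap (fun n : ℕ × ℕ => min n.1 n.2) atTop, 6 ≤ min n.1 n.2 :=
    tendsto_comap.eventually_ge_atTop 6
  have hdist : ∀ᵐ ω ∂P, ∀ k : ℕ, ∀ᶠ n : ℕ+ × ℕ+ in cofinite, 6 ≤ (n.1 : ℕ) → 6 ≤ (n.2 : ℕ) →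
      dist (θhat n.1 n.2 ω) θ₀ < 1 / (k + 1) :=
    ae_all_iff.2 fun k => hθ.ae_eventually_dist_lt hΘ hΘsub hθ₀ hlam₀ hmu₀ hamp hindep hlaw hν
      Nat.one_div_pos_of_nat
  filter_upwards [hdist] with ω hω
  refine Metric.tendsto_nhds.2 fun δ hδ => ?_
  obtain ⟨k, hk⟩ := exists_nat_one_div_lt hδ
  filter_upwards [eventually_comap_min_of_cofinite (q := fun T S => 6 ≤ T → 6 ≤ S →
    dist (θhat T S ω) θ₀ < 1 / (k + 1)) (hω k), hsix] with n hn h6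
  exact (hn (h6.trans (min_le_left _ _)) (h6.trans (min_le_right _ _))).trans hk

theorem theorem1 {Ω : Type*} [MeasurableSpace Ω] (P : Measure Ω) [IsProbabilityMeasure P]
    (K : Set ℝ) (hK : IsCompact K)
    (A₀ B₀ lam₀ mu₀ : ℝ)
    (hint : (A₀, B₀, lam₀, mu₀) ∈ interior (LADSinusoid.paramSpace K))
    (hamp : A₀ ≠ 0 ∨ B₀ ≠ 0)
    (ε : ℕ → ℕ → Ω → ℝ) (g : ℝ → ℝ) (hε : LADSinusoid.NoiseAssumption P ε g)
    (θhat : ℕ → ℕ → Ω → LADSinusoid.Param)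
    (hθ : LADSinusoid.IsLADEstimator (LADSinusoid.paramSpace K)
      (LADSinusoid.obs (A₀, B₀, lam₀, mu₀) ε) θhat) :
    ∀ᵐ ω ∂P, Tendsto (fun n : ℕ × ℕ => θhat n.1 n.2 ω)
      (comap (fun n : ℕ × ℕ => min n.1 n.2) atTop) (𝓝 (A₀, B₀, lam₀, mu₀)) := by
  obtain ⟨hlam₀, hmu₀⟩ := LADSinusoid.mem_Ioo_of_mem_interior_paramSpace hint
  exact theorem1_general P (LADSinusoid.isBounded_paramSpace hK.isBounded)
    (LADSinusoid.paramSpace_mono K.subset_univ) (interior_subset hint) hlam₀ hmu₀ hamp hε.indep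
    hε.hasLaw hε.isMedian_iff hθ
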